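/- **Setting.** Let $R$ be a (linearly) ordered commutative ring with $1$ and $C=R(i)$, $i^2=-1$, with complex conjugation. A $^*$-algebra is an associative, not necessarily unital $C$-algebra with an antilinear involutive anti-automorphism $^*$. A $^*$-algebra $A$ is *non-degenerate* if $A\cdot a=0$ or $a\cdot A=0$ implies $a=0$, and *idempotent* if the products $a_1a_2$ span $A$. A $C$-linear $\omega:A\to C$ is *positive* if $\omega(a^*a)\ge 0$ for all $a$; $a\in A$ is *positive* if $\omega(a)\ge0$ for all positive $\omega$. Below $A,B,\dots$ are non-degenerate idempotent $^*$-algebras over $C$. A $(B,A)$-*inner-product bimodule* is a $(B,A)$-bimodule $E$ (with compatible $C$-module structure) with $B\cdot E=E$ (the span of the products $b\cdot x$ is $E$) and a map $\langle\cdot,\cdot\rangle_A:E\times E\to A$, $C$-linear in the second and antilinear in the first argument, with $\langle x,y\rangle_A=\langle y,x\rangle_A^*$, $\langle x,y\cdot a\rangle_A=\langle x,y\rangle_A\,a$, $\langle b\cdot x,y\rangle_A=\langle x,b^*\cdot y\rangle_A$, which is non-degenerate ($\langle x,y\rangle_A=0$ for all $y$ implies $x=0$). It is a *pre-Hilbert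 bimodule* if $\langle\cdot,\cdot\rangle_A$ is *completely positive*: for all $n$ and $x_1,\dots,x_n\in E$ the matrix $(\langle x_i,x_j\rangle_A)_{ij}$ is positive in $M_n(A)$. Isomorphisms are bijective bimodule maps preserving the inner products. The composition of a $(D,B)$-bimodule $F$ and a $(B,A)$-bimodule $E$ is the internal tensor product $F\,\widehat\otimes_B E$: the quotient of $F\otimes_B E$ by the degeneracy space $\{z:\langle z,\cdot\rangle=0\}$ of the inner product determined by $\langle y_1\otimes x_1,y_2\otimes x_2\rangle=\langle x_1,\langle y_1,y_2\rangle_B\cdot x_2\rangle_A$. The identity of $A$ is the bimodule ${}_AA_A$ with $\langle a,b\rangle=a^*b$. The isomorphism class of a $(B,A)$-inner-product (resp. pre-Hilbert) bimodule $E$ is a morphism $A\to B$ of $\mathsf{Bim}^*$ (resp. $\mathsf{Bim}^*_+$); $E$ is *invertible* if there is an $(A,B)$-inner-product (resp. pre-Hilbert) bimodule $E'$ with $E'\,\widehat\otimes_B E\cong A$ and $E\,\widehat\otimes_A E'\cong B$. $A$ and $B$ are *isomorphic* in $\mathsf{Bim}^*$ (resp. $\mathsf{Bim}^*_+$) if there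 is an invertible $(B,A)$-bimodule of the respective kind. A $^*$-*equivalence bimodule* is a $(B,A)$-inner-product bimodule $E$ together with a map ${}_B\langle\cdot,\cdot\rangle:E\times E\to B$, linear in the first and antilinear in the second argument, with ${}_B\langle x,y\rangle={}_B\langle y,x\rangle^*$, ${}_B\langle b\cdot x,y\rangle=b\,{}_B\langle x,y\rangle$ and ${}_B\langle x\cdot a,y\rangle={}_B\langle x,y\cdot a^*\rangle$, which is non-degenerate, such that the values of each of the two inner products span $B$, resp. $A$, such that $x\cdot\langle y,z\rangle_A={}_B\langle x,y\rangle\cdot z$ for all $x,y,z\in E$, and such that $E\cdot A=E$. It is a *strong equivalence bimodule* if both inner products are completely positive (for ${}_B\langle\cdot,\cdot\rangle$: all matrices $({}_B\langle x_i,x_j\rangle)_{ij}$ are positive in $M_n(B)$). $A$ and $B$ are $^*$- (resp. *strongly*) *Morita equivalent* if a $^*$- (resp. strong) $(B,A)$-equivalence bimodule exists. **Theorem 6.1.** (1) A $(B,A)$-inner-product (resp. pre-Hilbert) bimodule $(E,\langle\cdot,\cdot\rangle_A)$ is invertible in $\mathsf{Bim}^*$ (resp. $\mathsf{Bim}^*_+$)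 if and only if there is a $B$-valued inner product ${}_B\langle\cdot,\cdot\rangle$ on $E$ making $(E,{}_B\langle\cdot,\cdot\rangle,\langle\cdot,\cdot\rangle_A)$ a $^*$- (resp. strong) equivalence bimodule. (2) $A$ and $B$ are $^*$- (resp. strongly) Morita equivalent if and only if they are isomorphic in $\mathsf{Bim}^*$ (resp. $\mathsf{Bim}^*_+$). (3) The isomorphism classes of invertible bimodules in $\mathsf{Bim}^*$ (resp. $\mathsf{Bim}^*_+$), with the above composition and identities, form a groupoid on the class of non-degenerate idempotent $^*$-algebras over $C$ (the $^*$-Picard groupoid, resp. the strong Picard groupoid). -/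

import Mathlib

open scoped TensorProduct

universe u v

/-- The ring `C = R(i)` with `i ^ 2 = -1`; its `star` is complex conjugation. -/
abbrev Cplx (R : Type v) [CommRing R] : Type v := QuadraticAlgebra R (-1) 0

/-- An element of `C = R(i)` is `≥ 0` if it lies in `R` and is `≥ 0` there. -/
def Cplx.Nonneg {R : Type v} [CommRing R] [LinearOrder R] (z : Cplx R) : Prop :=
  0 ≤ z.re ∧ z.im = 0

/-! ### Positivity in star algebras -/

section Positivity

variable (R : Type v) [CommRing R] [LinearOrder R]

/-- Positive linear functionals `ω : A → C`, that is, `ω (a* a) ≥ 0` for all `a`. -/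
def IsPositiveFunctional {A : Type u} [NonUnitalRing A] [StarRing A] [Module (Cplx R) A]
    (ω : A →ₗ[Cplx R] Cplx R) : Prop :=
  ∀ a : A, Cplx.Nonneg (ω (star a * a))

/-- Positive elements: those on which all positive linear functionals are `≥ 0`. -/
def IsPositiveElement {A : Type u} [NonUnitalRing A] [StarRing A] [Module (Cplx R) A]
    (a : A) : Prop :=
  ∀ ω : A →ₗ[Cplx R] Cplx R, IsPositiveFunctional R ω → Cplx.Nonneg (ω a)

/-- A map `ip : E × E → A` is completely positive if for all `n` and `x ∈ E ^ n` the matrix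
`(ip (x i) (x j))` is a positive element of the star algebra of `n × n` matrices over `A`. -/
def IsCompletelyPositive {A : Type u} [NonUnitalRing A] [StarRing A] [Module (Cplx R) A]
    {E : Type u} (ip : E → E → A) : Prop :=
  ∀ (n : ℕ) (x : Fin n → E),
    IsPositiveElement R (Matrix.of fun i j => ip (x i) (x j) : Matrix (Fin n) (Fin n) A)

end Positivity

/-! ### Non-degenerate idempotent star algebras -/

/-- A star algebra over `C = R(i)` (associative, not necessarily unital) which is non-degenerate
and idempotent. -/
structure NIStarAlg (R : Type v) [CommRing R] where
  carrier : Type u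
  [ring : NonUnitalRing carrier]
  [starRing : StarRing carrier]
  [module : Module (Cplx R) carrier]
  [isScalarTower : IsScalarTower (Cplx R) carrier carrier]
  [smulCommClass : SMulCommClass (Cplx R) carrier carrier]
  [starModule : StarModule (Cplx R) carrier]
  nondeg_left : ∀ a : carrier, (∀ b : carrier, b * a = 0) → a = 0
  nondeg_right : ∀ a : carrier, (∀ b : carrier, a * b = 0) → a = 0
  idempotent : Submodule.span (Cplx R) {a : carrier | ∃ b c : carrier, a = b * c} = ⊤

namespace NIStarAlg

instance {R : Type v} [CommRing R] : CoeSort (NIStarAlg.{u, v} R) (Type u) := ⟨carrier⟩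

attribute [instance] ring starRing module isScalarTower smulCommClass starModule

end NIStarAlg

/-! ### Inner-product bimodules -/

/-- A `(B, A)`-inner-product bimodule: a right `A`-module `E` with a non-degenerate `A`-valued
inner product (conjugate-linear in the first and linear in the second argument) and a strongly
non-degenerate star representation of `B` on `E` by adjointable operators.
Here `lact b x` is `b · x` and `ract a x` is `x · a`; modules over non-unital algebras are not
available as classes, so the actions are given as bilinear maps. -/
structure InnerProductBimodule {R : Type v} [CommRing R] (B A : NIStarAlg.{u, v} R) where
  carrier : Type u
  [addCommGroup : AddCommGroup carrier]
  [module : Module (Cplx R) carrier]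
  lact : B →ₗ[Cplx R] carrier →ₗ[Cplx R] carrier
  ract : A →ₗ[Cplx R] carrier →ₗ[Cplx R] carrier
  lact_mul : ∀ (b b' : B) (x : carrier), lact (b * b') x = lact b (lact b' x)
  ract_mul : ∀ (a a' : A) (x : carrier), ract (a * a') x = ract a' (ract a x)
  lact_ract : ∀ (b : B) (a : A) (x : carrier), lact b (ract a x) = ract a (lact b x)
  inner : carrier →ₗ⋆[Cplx R] carrier →ₗ[Cplx R] A
  star_inner : ∀ x y : carrier, star (inner x y) = inner y x
  inner_ract : ∀ (x y : carrier) (a : A), inner x (ract a y) = inner x y * a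
  inner_nondeg : ∀ x : carrier, (∀ y : carrier, inner x y = 0) → x = 0
  inner_lact : ∀ (b : B) (x y : carrier), inner (lact b x) y = inner x (lact (star b) y)
  span_lact : Submodule.span (Cplx R) {z : carrier | ∃ (b : B) (x : carrier), z = lact b x} = ⊤

namespace InnerProductBimodule

instance {R : Type v} [CommRing R] {B A : NIStarAlg.{u, v} R} :
    CoeSort (InnerProductBimodule B A) (Type u) := ⟨carrier⟩

attribute [instance] addCommGroup module

section Basic

variable {R : Type v} [CommRing R] {A B D : NIStarAlg.{u, v} R}

/-- A pre-Hilbert bimodule is an inner-product bimodule with completely positive inner product. -/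
def IsPreHilbert [LinearOrder R] (E : InnerProductBimodule B A) : Prop :=
  IsCompletelyPositive R fun x y : E => E.inner x y

/-- Isomorphisms of inner-product bimodules: bijective bimodule homomorphisms preserving the
inner products. -/
structure Iso (E F : InnerProductBimodule B A) where
  toEquiv : E ≃ₗ[Cplx R] F
  map_lact : ∀ (b : B) (x : E), toEquiv (E.lact b x) = F.lact b (toEquiv x)
  map_ract : ∀ (a : A) (x : E), toEquiv (E.ract a x) = F.ract a (toEquiv x)
  map_inner : ∀ x y : E, F.inner (toEquiv x) (toEquiv y) = E.inner x y

theorem Iso.refl (E : InnerProductBimodule B A) : Nonempty (Iso E E) :=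
  ⟨⟨LinearEquiv.refl _ _, fun _ _ => rfl, fun _ _ => rfl, fun _ _ => rfl⟩⟩

theorem Iso.symm {E F : InnerProductBimodule B A} (f : Iso E F) : Nonempty (Iso F E) :=
  ⟨⟨f.toEquiv.symm,
    fun b x => by rw [LinearEquiv.symm_apply_eq, f.map_lact, LinearEquiv.apply_symm_apply],
    fun a x => by rw [LinearEquiv.symm_apply_eq, f.map_ract, LinearEquiv.apply_symm_apply],
    fun x y => by rw [← f.map_inner, LinearEquiv.apply_symm_apply, LinearEquiv.apply_symm_apply]⟩⟩

theorem Iso.trans {E F G : InnerProductBimodule B A} (f : Iso E F) (g : Iso F G) :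
    Nonempty (Iso E G) :=
  ⟨⟨f.toEquiv.trans g.toEquiv,
    fun b x => by simp [f.map_lact, g.map_lact],
    fun a x => by simp [f.map_ract, g.map_ract],
    fun x y => by simp [f.map_inner, g.map_inner]⟩⟩

theorem Iso.isPreHilbert [LinearOrder R] {E F : InnerProductBimodule B A} (f : Iso E F)
    (h : E.IsPreHilbert) : F.IsPreHilbert := by
  intro n x
  have := h n fun i => f.toEquiv.symm (x i)
  simpa only [← f.map_inner, LinearEquiv.apply_symm_apply] using this

theorem inner_ract_left (E : InnerProductBimodule B A) (x y : E) (a : A) :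
    E.inner (E.ract a x) y = star a * E.inner x y := by
  rw [← E.star_inner, E.inner_ract, star_mul, E.star_inner]

/-- The relation "isomorphic" on inner-product bimodules. -/
instance setoid (B A : NIStarAlg.{u, v} R) : Setoid (InnerProductBimodule B A) where
  r E F := Nonempty (Iso E F)
  iseqv := ⟨Iso.refl, fun ⟨f⟩ => f.symm, fun ⟨f⟩ ⟨g⟩ => f.trans g⟩

/-- The algebra `A` as an `(A, A)`-bimodule, with inner product `⟨a, b⟩ = a* b`. -/
abbrev unit (A : NIStarAlg.{u, v} R) : InnerProductBimodule A A where
  carrier := A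
  lact := LinearMap.mul (Cplx R) A
  ract := (LinearMap.mul (Cplx R) A).flip
  lact_mul b b' x := by simp [mul_assoc]
  ract_mul b b' x := by simp [mul_assoc]
  lact_ract b a x := by simp [mul_assoc]
  inner := LinearMap.mk₂'ₛₗ (starRingEnd (Cplx R)) (RingHom.id (Cplx R))
    (fun a b : A => star a * b)
    (fun a a' b => by rw [star_add, add_mul])
    (fun c a b => by rw [star_smul, smul_mul_assoc, starRingEnd_apply])
    (fun a b b' => by rw [mul_add])
    (fun c a b => by rw [mul_smul_comm, RingHom.id_apply])
  star_inner x y := by simp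
  inner_ract x y a := by simp [mul_assoc]
  inner_nondeg x hx := by
    have h : star x = 0 := A.nondeg_right _ fun b => hx b
    rwa [star_eq_zero] at h
  inner_lact b x y := by simp [mul_assoc]
  span_lact := A.idempotent

end Basic

/-! ### Internal tensor products -/

section Tensor

variable {R : Type v} [CommRing R] {A B D : NIStarAlg.{u, v} R}
  (F : InnerProductBimodule D B) (E : InnerProductBimodule B A)

/-- The `A`-valued inner product on `F ⊗ E` with
`⟨y₁ ⊗ x₁, y₂ ⊗ x₂⟩ = ⟨x₁, ⟨y₁, y₂⟩ · x₂⟩`; the tensor product is taken over `C`. -/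
noncomputable def tensorForm :
    (F ⊗[Cplx R] E) →ₗ⋆[Cplx R] (F ⊗[Cplx R] E) →ₗ[Cplx R] A :=
  TensorProduct.lift <| LinearMap.mk₂'ₛₗ (starRingEnd (Cplx R)) (starRingEnd (Cplx R))
    (fun (y : F) (x : E) =>
      TensorProduct.lift ((E.lact ∘ₗ F.inner y).compr₂ (E.inner x)))
    (fun y y' x => TensorProduct.ext' fun _ _ => by simp)
    (fun c y x => TensorProduct.ext' fun _ _ => by simp)
    (fun y x x' => TensorProduct.ext' fun _ _ => by simp)
    (fun c y x => TensorProduct.ext' fun _ _ => by simp)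

theorem tensorForm_tmul (y₁ y₂ : F) (x₁ x₂ : E) :
    tensorForm F E (y₁ ⊗ₜ x₁) (y₂ ⊗ₜ x₂) = E.inner x₁ (E.lact (F.inner y₁ y₂) x₂) := by
  simp [tensorForm]

theorem star_tensorForm (z w : F ⊗[Cplx R] E) :
    star (tensorForm F E z w) = tensorForm F E w z := by
  induction z with
  | zero => simp
  | add z z' h h' => simp [h, h']
  | tmul y x =>
    induction w with
    | zero => simp
    | add w w' h h' => simp [h, h']
    | tmul y' x' =>
      rw [tensorForm_tmul, tensorForm_tmul, E.star_inner, E.inner_lact, F.star_inner]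

/-- The left action of `D` on `F ⊗ E`. -/
noncomputable def tensorLact (d : D) : (F ⊗[Cplx R] E) →ₗ[Cplx R] (F ⊗[Cplx R] E) :=
  (F.lact d).rTensor E

/-- The right action of `A` on `F ⊗ E`. -/
noncomputable def tensorRact (a : A) : (F ⊗[Cplx R] E) →ₗ[Cplx R] (F ⊗[Cplx R] E) :=
  (E.ract a).lTensor F

theorem tensorForm_lact (d : D) (z w : F ⊗[Cplx R] E) :
    tensorForm F E (tensorLact F E d z) w = tensorForm F E z (tensorLact F E (star d) w) := by
  induction z with
  | zero => simp
  | add z z' h h' => simp [h, h']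
  | tmul y x =>
    induction w with
    | zero => simp
    | add w w' h h' => simp [h, h']
    | tmul y' x' =>
      simp [tensorLact, tensorForm_tmul, F.inner_lact]

theorem tensorForm_ract (z w : F ⊗[Cplx R] E) (a : A) :
    tensorForm F E z (tensorRact F E a w) = tensorForm F E z w * a := by
  induction z with
  | zero => simp
  | add z z' h h' => simp [h, h', add_mul]
  | tmul y x =>
    induction w with
    | zero => simp
    | add w w' h h' => simp [h, h', add_mul]
    | tmul y' x' =>
      simp [tensorRact, tensorForm_tmul, E.lact_ract, E.inner_ract]

/-- The degeneracy space of the inner product on `F ⊗ E`. -/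
noncomputable def degeneracy : Submodule (Cplx R) (F ⊗[Cplx R] E) :=
  LinearMap.ker (tensorForm F E)

theorem mem_degeneracy {z : F ⊗[Cplx R] E} :
    z ∈ degeneracy F E ↔ ∀ w, tensorForm F E z w = 0 := by
  rw [degeneracy, LinearMap.mem_ker, LinearMap.ext_iff]; rfl

theorem mem_degeneracy' {z : F ⊗[Cplx R] E} :
    z ∈ degeneracy F E ↔ ∀ w, tensorForm F E w z = 0 := by
  rw [mem_degeneracy]
  refine forall_congr' fun w => ?_
  rw [← star_tensorForm, star_eq_zero]

/-- The relations `(y · b) ⊗ x = y ⊗ (b · x)` which define the tensor product over `B` hold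
modulo the degeneracy space. Hence the quotient of `F ⊗[C] E` by its degeneracy space is the same
as the quotient of the tensor product `F ⊗[B] E` over `B` by the degeneracy space of the induced
inner product there. -/
theorem balanced_mem_degeneracy (y : F) (b : B) (x : E) :
    (F.ract b y) ⊗ₜ[Cplx R] x - y ⊗ₜ[Cplx R] (E.lact b x) ∈ degeneracy F E := by
  rw [mem_degeneracy']
  intro w
  induction w with
  | zero => simp
  | add w w' h h' => rw [map_add, LinearMap.add_apply, h, h', add_zero]
  | tmul y' x' =>
    simp [map_sub, tensorForm_tmul, F.inner_ract, E.lact_mul]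

theorem tensorLact_mem (d : D) : degeneracy F E ≤ (degeneracy F E).comap (tensorLact F E d) := by
  intro z hz
  rw [Submodule.mem_comap, mem_degeneracy]
  intro w
  rw [tensorForm_lact]
  exact (mem_degeneracy F E).1 hz _

theorem tensorRact_mem (a : A) : degeneracy F E ≤ (degeneracy F E).comap (tensorRact F E a) := by
  intro z hz
  rw [Submodule.mem_comap, mem_degeneracy']
  intro w
  rw [tensorForm_ract, (mem_degeneracy' F E).1 hz, zero_mul]

/-- The underlying module of the internal tensor product: `F ⊗ E` modulo its degeneracy space. -/
abbrev TensorCarrier : Type u := (F ⊗[Cplx R] E) ⧸ degeneracy F E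

/-- The inner product induced on the quotient by the degeneracy space. -/
noncomputable def quotientInner :
    TensorCarrier F E →ₗ⋆[Cplx R] TensorCarrier F E →ₗ[Cplx R] A :=
  (degeneracy F E).liftQ
    (LinearMap.mk₂'ₛₗ (starRingEnd (Cplx R)) (RingHom.id (Cplx R))
      (fun z (w : TensorCarrier F E) => (degeneracy F E).liftQ (tensorForm F E z)
        (fun _ hw => (mem_degeneracy' F E).1 hw z) w)
      (fun z z' w => Submodule.Quotient.induction_on _ w fun w =>
        LinearMap.congr_fun ((tensorForm F E).map_add z z') w)
      (fun c z w => Submodule.Quotient.induction_on _ w fun w =>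
        LinearMap.congr_fun ((tensorForm F E).map_smulₛₗ c z) w)
      (fun _ _ _ => map_add _ _ _)
      (fun _ _ _ => map_smul _ _ _))
    (fun _ hz => LinearMap.mem_ker.2 <| LinearMap.ext fun w =>
      Submodule.Quotient.induction_on _ w fun w => (mem_degeneracy F E).1 hz w)

theorem quotientInner_mk (z w : F ⊗[Cplx R] E) :
    quotientInner F E (Submodule.Quotient.mk z) (Submodule.Quotient.mk w) = tensorForm F E z w :=
  rfl

/-- The left action induced on the quotient by the degeneracy space. -/
noncomputable def quotientLact :
    D →ₗ[Cplx R] TensorCarrier F E →ₗ[Cplx R] TensorCarrier F E :=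
  LinearMap.mk₂ (Cplx R)
    (fun (d : D) z => (degeneracy F E).mapQ _ (tensorLact F E d) (tensorLact_mem F E d) z)
    (fun d d' z => Submodule.Quotient.induction_on _ z fun z => by
      rw [Submodule.mapQ_apply, Submodule.mapQ_apply, Submodule.mapQ_apply,
        ← Submodule.Quotient.mk_add, ← LinearMap.add_apply]
      simp only [tensorLact, map_add, LinearMap.rTensor_add])
    (fun c d z => Submodule.Quotient.induction_on _ z fun z => by
      rw [Submodule.mapQ_apply, Submodule.mapQ_apply,
        ← Submodule.Quotient.mk_smul, ← LinearMap.smul_apply]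
      simp only [tensorLact, map_smul, LinearMap.rTensor_smul])
    (fun d z z' => map_add _ _ _)
    (fun c d z => map_smul _ _ _)

theorem quotientLact_mk (d : D) (z : F ⊗[Cplx R] E) :
    quotientLact F E d (Submodule.Quotient.mk z) = Submodule.Quotient.mk (tensorLact F E d z) :=
  rfl

/-- The right action induced on the quotient by the degeneracy space. -/
noncomputable def quotientRact :
    A →ₗ[Cplx R] TensorCarrier F E →ₗ[Cplx R] TensorCarrier F E :=
  LinearMap.mk₂ (Cplx R)
    (fun (a : A) z => (degeneracy F E).mapQ _ (tensorRact F E a) (tensorRact_mem F E a) z)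
    (fun a a' z => Submodule.Quotient.induction_on _ z fun z => by
      rw [Submodule.mapQ_apply, Submodule.mapQ_apply, Submodule.mapQ_apply,
        ← Submodule.Quotient.mk_add, ← LinearMap.add_apply]
      simp only [tensorRact, map_add, LinearMap.lTensor_add])
    (fun c a z => Submodule.Quotient.induction_on _ z fun z => by
      rw [Submodule.mapQ_apply, Submodule.mapQ_apply,
        ← Submodule.Quotient.mk_smul, ← LinearMap.smul_apply]
      simp only [tensorRact, map_smul, LinearMap.lTensor_smul])
    (fun a z z' => map_add _ _ _)
    (fun c a z => map_smul _ _ _)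

theorem quotientRact_mk (a : A) (z : F ⊗[Cplx R] E) :
    quotientRact F E a (Submodule.Quotient.mk z) = Submodule.Quotient.mk (tensorRact F E a z) :=
  rfl

theorem span_quotientLact : Submodule.span (Cplx R)
    {z : TensorCarrier F E | ∃ (d : D) (x : TensorCarrier F E), z = quotientLact F E d x} = ⊤ := by
  rw [eq_top_iff]
  rintro z -
  induction z using Submodule.Quotient.induction_on with
  | H z =>
    induction z with
    | zero => exact zero_mem _
    | add z z' h h' => rw [Submodule.Quotient.mk_add]; exact add_mem h h'
    | tmul y x =>
      have hy : y ∈ Submodule.span (Cplx R) {z : F | ∃ (d : D) (y : F), z = F.lact d y} := by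
        rw [F.span_lact]; trivial
      induction hy using Submodule.span_induction with
      | mem y hy =>
        obtain ⟨d, y', rfl⟩ := hy
        exact Submodule.subset_span ⟨d, Submodule.Quotient.mk (y' ⊗ₜ x), rfl⟩
      | zero => rw [TensorProduct.zero_tmul]; exact zero_mem _
      | add y y' _ _ h h' =>
        rw [TensorProduct.add_tmul, Submodule.Quotient.mk_add]; exact add_mem h h'
      | smul c y _ h =>
        rw [← TensorProduct.smul_tmul', Submodule.Quotient.mk_smul]
        exact Submodule.smul_mem _ c h

/-- The internal tensor product of `F` and `E` over `B`: the tensor product modulo the degeneracy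
space of its inner product, with the induced inner product and actions. -/
noncomputable def tensor : InnerProductBimodule D A where
  carrier := TensorCarrier F E
  lact := quotientLact F E
  ract := quotientRact F E
  lact_mul d d' z := by
    induction z using Submodule.Quotient.induction_on with
    | H z =>
      have h : F.lact (d * d') = F.lact d ∘ₗ F.lact d' := LinearMap.ext fun y => F.lact_mul d d' y
      rw [quotientLact_mk, quotientLact_mk, quotientLact_mk]
      simp only [tensorLact, h, LinearMap.rTensor_comp, LinearMap.comp_apply]
  ract_mul a a' z := by
    induction z using Submodule.Quotient.induction_on with
    | H z =>
      have h : E.ract (a * a') = E.ract a' ∘ₗ E.ract a := LinearMap.ext fun y => E.ract_mul a a' y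
      rw [quotientRact_mk, quotientRact_mk, quotientRact_mk]
      simp only [tensorRact, h, LinearMap.lTensor_comp, LinearMap.comp_apply]
  lact_ract d a z := by
    induction z using Submodule.Quotient.induction_on with
    | H z =>
      rw [quotientRact_mk, quotientLact_mk, quotientLact_mk, quotientRact_mk]
      simp only [tensorLact, tensorRact]
      rw [← LinearMap.comp_apply, ← LinearMap.comp_apply, LinearMap.rTensor_comp_lTensor,
        LinearMap.lTensor_comp_rTensor]
  inner := quotientInner F E
  star_inner z w := by
    induction z using Submodule.Quotient.induction_on with
    | H z =>
      induction w using Submodule.Quotient.induction_on with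
      | H w => exact star_tensorForm F E z w
  inner_ract z w a := by
    induction z using Submodule.Quotient.induction_on with
    | H z =>
      induction w using Submodule.Quotient.induction_on with
      | H w => exact tensorForm_ract F E z w a
  inner_nondeg z hz := by
    induction z using Submodule.Quotient.induction_on with
    | H z =>
      rw [Submodule.Quotient.mk_eq_zero, mem_degeneracy]
      exact fun w => hz (Submodule.Quotient.mk w)
  inner_lact d z w := by
    induction z using Submodule.Quotient.induction_on with
    | H z =>
      induction w using Submodule.Quotient.induction_on with
      | H w => exact tensorForm_lact F E d z w
  span_lact := span_quotientLact F E

variable {F E} in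
theorem tensorForm_congr {F' : InnerProductBimodule D B} {E' : InnerProductBimodule B A}
    (f : Iso F F') (e : Iso E E') (z w : F ⊗[Cplx R] E) :
    tensorForm F' E' (TensorProduct.congr f.toEquiv e.toEquiv z)
      (TensorProduct.congr f.toEquiv e.toEquiv w) = tensorForm F E z w := by
  induction z with
  | zero => simp
  | add z z' h h' => simp only [map_add, LinearMap.add_apply, h, h']
  | tmul y x =>
    induction w with
    | zero => simp
    | add w w' h h' => simp only [map_add, h, h']
    | tmul y' x' =>
      rw [TensorProduct.congr_tmul, TensorProduct.congr_tmul, tensorForm_tmul, tensorForm_tmul,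
        f.map_inner, ← e.map_lact, e.map_inner]

variable {F E} in
theorem Iso.tensor {F' : InnerProductBimodule D B} {E' : InnerProductBimodule B A}
    (f : Iso F F') (e : Iso E E') : Nonempty (Iso (F.tensor E) (F'.tensor E')) := by
  refine ⟨⟨Submodule.Quotient.equiv (degeneracy F E) (degeneracy F' E')
    (TensorProduct.congr f.toEquiv e.toEquiv) ?_, ?_, ?_, ?_⟩⟩
  · ext z
    rw [Submodule.mem_map_equiv, mem_degeneracy, mem_degeneracy]
    constructor
    · intro h w
      have := h ((TensorProduct.congr f.toEquiv e.toEquiv).symm w)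
      rwa [← tensorForm_congr f e, LinearEquiv.apply_symm_apply,
        LinearEquiv.apply_symm_apply] at this
    · intro h w
      rw [← tensorForm_congr f e, LinearEquiv.apply_symm_apply]
      exact h _
  · intro d z
    induction z using Submodule.Quotient.induction_on with
    | H z =>
      refine congrArg Submodule.Quotient.mk ?_
      induction z with
      | zero => simp
      | add z z' h h' => simp only [map_add, h, h']
      | tmul y x => simp [tensorLact, f.map_lact]
  · intro a z
    induction z using Submodule.Quotient.induction_on with
    | H z =>
      refine congrArg Submodule.Quotient.mk ?_
      induction z with
      | zero => simp
      | add z z' h h' => simp only [map_add, h, h']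
      | tmul y x => simp [tensorRact, e.map_ract]
  · intro z w
    induction z using Submodule.Quotient.induction_on with
    | H z =>
      induction w using Submodule.Quotient.induction_on with
      | H w => exact tensorForm_congr f e z w

end Tensor

end InnerProductBimodule

/-! ### Isomorphism classes of bimodules as morphisms -/

/-- Morphisms `A ⟶ B`: isomorphism classes of `(B, A)`-inner-product bimodules. -/
def BimMor {R : Type v} [CommRing R] (B A : NIStarAlg.{u, v} R) : Type (max (u + 1) v) :=
  Quotient (InnerProductBimodule.setoid B A)

namespace BimMor

variable {R : Type v} [CommRing R] {A B D : NIStarAlg.{u, v} R}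

/-- The isomorphism class of a bimodule. -/
def mk (E : InnerProductBimodule B A) : BimMor B A := Quotient.mk _ E

/-- The identity morphism of `A`: the class of the bimodule `A`. -/
def id (A : NIStarAlg.{u, v} R) : BimMor A A := mk (InnerProductBimodule.unit A)

/-- Composition of morphisms: the internal tensor product. -/
noncomputable def comp (f : BimMor D B) (g : BimMor B A) : BimMor D A :=
  Quotient.liftOn₂ f g (fun F E => mk (F.tensor E)) fun _ _ _ _ hf hg =>
    Quotient.sound (Nonempty.elim hf fun f => Nonempty.elim hg fun g => f.tensor g)

/-- The morphism is the class of a pre-Hilbert bimodule. -/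
def IsPreHilbert [LinearOrder R] (f : BimMor B A) : Prop :=
  ∃ E : InnerProductBimodule B A, E.IsPreHilbert ∧ mk E = f

/-- Invertible among the isomorphism classes of inner-product bimodules. -/
def IsInvertible (f : BimMor B A) : Prop :=
  ∃ g : BimMor A B, comp g f = id A ∧ comp f g = id B

/-- Invertible among the isomorphism classes of pre-Hilbert bimodules. -/
def IsStronglyInvertible [LinearOrder R] (f : BimMor B A) : Prop :=
  f.IsPreHilbert ∧ ∃ g : BimMor A B, g.IsPreHilbert ∧ comp g f = id A ∧ comp f g = id B

/-- The morphisms with the property `P` form a groupoid on all objects, with the above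
composition and identities. -/
structure FormGroupoid (P : ∀ {B A : NIStarAlg.{u, v} R}, BimMor B A → Prop) : Prop where
  id_mem : ∀ A : NIStarAlg.{u, v} R, P (id A)
  comp_mem : ∀ {A B D : NIStarAlg.{u, v} R} (f : BimMor D B) (g : BimMor B A),
    P f → P g → P (comp f g)
  assoc : ∀ {A B D K : NIStarAlg.{u, v} R} (f : BimMor K D) (g : BimMor D B) (h : BimMor B A),
    P f → P g → P h → comp (comp f g) h = comp f (comp g h)
  id_comp : ∀ {A B : NIStarAlg.{u, v} R} (f : BimMor B A), P f → comp (id B) f = f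
  comp_id : ∀ {A B : NIStarAlg.{u, v} R} (f : BimMor B A), P f → comp f (id A) = f
  inv_mem : ∀ {A B : NIStarAlg.{u, v} R} (f : BimMor B A), P f →
    ∃ g : BimMor A B, P g ∧ comp g f = id A ∧ comp f g = id B

end BimMor

/-! ### Equivalence bimodules and Morita equivalence -/

/-- `E`, with its `A`-valued inner product and the `B`-valued inner product `ip` (linear in the
first and conjugate-linear in the second argument), is a star equivalence bimodule. Non-degeneracy
of the `A`-valued inner product, its compatibility with the `B`-action and `B · E = E` are part of
`InnerProductBimodule`. -/
structure IsStarEquivalence {R : Type v} [CommRing R] {B A : NIStarAlg.{u, v} R}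
    (E : InnerProductBimodule B A) (ip : E →ₗ[Cplx R] E →ₗ⋆[Cplx R] B) : Prop where
  star_ip : ∀ x y : E, star (ip x y) = ip y x
  ip_lact : ∀ (b : B) (x y : E), ip (E.lact b x) y = b * ip x y
  ip_nondeg : ∀ x : E, (∀ y : E, ip x y = 0) → x = 0
  ip_full : Submodule.span (Cplx R) {b : B | ∃ x y : E, b = ip x y} = ⊤
  ip_ract : ∀ (a : A) (x y : E), ip (E.ract a x) y = ip x (E.ract (star a) y)
  inner_full : Submodule.span (Cplx R) {a : A | ∃ x y : E, a = E.inner x y} = ⊤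
  ract_inner : ∀ x y z : E, E.ract (E.inner y z) x = E.lact (ip x y) z
  span_ract : Submodule.span (Cplx R) {z : E | ∃ (a : A) (x : E), z = E.ract a x} = ⊤

/-- A strong equivalence bimodule: a star equivalence bimodule both of whose inner products are
completely positive. -/
def IsStrongEquivalence {R : Type v} [CommRing R] [LinearOrder R] {B A : NIStarAlg.{u, v} R}
    (E : InnerProductBimodule B A) (ip : E →ₗ[Cplx R] E →ₗ⋆[Cplx R] B) : Prop :=
  IsStarEquivalence E ip ∧ E.IsPreHilbert ∧ IsCompletelyPositive R fun x y : E => ip x y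

/-- `A` and `B` are star Morita equivalent: there is a `(B, A)`-star equivalence bimodule. -/
def StarMoritaEquivalent {R : Type v} [CommRing R] (A B : NIStarAlg.{u, v} R) : Prop :=
  ∃ (E : InnerProductBimodule B A) (ip : E →ₗ[Cplx R] E →ₗ⋆[Cplx R] B), IsStarEquivalence E ip

/-- `A` and `B` are strongly Morita equivalent: there is a `(B, A)`-strong equivalence bimodule. -/
def StronglyMoritaEquivalent {R : Type v} [CommRing R] [LinearOrder R]
    (A B : NIStarAlg.{u, v} R) : Prop :=
  ∃ (E : InnerProductBimodule B A) (ip : E →ₗ[Cplx R] E →ₗ⋆[Cplx R] B), IsStrongEquivalence E ip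

/-! Tensor products are compared through one principle: a surjection from an algebraic tensor
product that respects the forms and left actions induces an isomorphism, because its kernel is the
degeneracy space (`nonempty_iso_of_surjective`, `nonempty_tensor_iso`). This yields associativity
and the left unit law for all bimodules. The right unit law would require `E · A = E`, which is not
assumed; for invertible `f` with inverse `g` it follows from `f ∘ id = f ∘ (g ∘ f) = (f ∘ g) ∘ f =
f`.

An equivalence bimodule is inverted by its conjugate `Ē`: the maps `x̄ ⊗ y ↦ ⟨x, y⟩_A` and `x ⊗ ȳ ↦
_B⟨x, y⟩` are onto by fullness and isometric by `x · ⟨y, z⟩_A = _B⟨x, y⟩ · z`.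

Conversely, let `E'` be inverse to `E`. An isomorphism `E ⊗ E' ≅ B` is a pairing `(x, v)` with
values in `B` (`Pairing`). The functionals `(x, ·)` are represented by vectors of `E'`
(`Pairing.exists_dual`), which gives an antilinear bijection `x ↦ x'` from `E` to `E'`, and `_B⟨x,
y⟩ = (x, y')` is the required inner product. The isomorphism `E' ⊗ E ≅ A` enters only through two
consequences: `A` acts faithfully on `E'`, and the values of `⟨·, ·⟩_A` span `A`. No coherence
between the two isomorphisms is needed.

For the strong version, `_B⟨x, y⟩ = ⟨x', y'⟩` is pulled back from `E'` and so inherits complete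
positivity, while internal tensor products preserve it (`IsPreHilbert.tensor`). -/

namespace InnerProductBimodule

/-! ### Isomorphism criteria, left unit law and associativity -/

variable {R : Type v} [CommRing R] {A B D K : NIStarAlg.{u, v} R}

theorem inner_left_ext {E : InnerProductBimodule B A} {x y : E}
    (h : ∀ z, E.inner x z = E.inner y z) : x = y := by
  rw [← sub_eq_zero]
  exact E.inner_nondeg _ fun z => by rw [map_sub, LinearMap.sub_apply, h, sub_self]

theorem inner_right_ext {E : InnerProductBimodule B A} {x y : E}
    (h : ∀ z, E.inner z x = E.inner z y) : x = y :=
  inner_left_ext fun z => by rw [← E.star_inner, h, E.star_inner]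

/-- Two surjections from a common module which induce the same form on it and intertwine the left
actions give an isomorphism. -/
theorem nonempty_iso_of_surjective {T : Type*} [AddCommGroup T] [Module (Cplx R) T]
    {X Y : InnerProductBimodule B A} (p : T →ₗ[Cplx R] X) (q : T →ₗ[Cplx R] Y)
    (hp : Function.Surjective p) (hq : Function.Surjective q)
    (hpq : ∀ t s, X.inner (p t) (p s) = Y.inner (q t) (q s)) (L : B → T → T)
    (hLp : ∀ b t, p (L b t) = X.lact b (p t)) (hLq : ∀ b t, q (L b t) = Y.lact b (q t)) :
    Nonempty (Iso X Y) := by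
  -- Since the targets are non-degenerate and the maps onto, both kernels are the degeneracy space
  -- of the common form.
  have hker : LinearMap.ker p = LinearMap.ker q := by
    ext t
    rw [LinearMap.mem_ker, LinearMap.mem_ker]
    constructor <;> intro h
    · refine Y.inner_nondeg _ fun y => ?_
      obtain ⟨s, rfl⟩ := hq y
      rw [← hpq, h, map_zero, LinearMap.zero_apply]
    · refine X.inner_nondeg _ fun x => ?_
      obtain ⟨s, rfl⟩ := hp x
      rw [hpq, h, map_zero, LinearMap.zero_apply]
  let e : X ≃ₗ[Cplx R] Y := (p.quotKerEquivOfSurjective hp).symm.trans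
    ((Submodule.quotEquivOfEq _ _ hker).trans (q.quotKerEquivOfSurjective hq))
  have he : ∀ t, e (p t) = q t := by
    intro t
    have h : (p.quotKerEquivOfSurjective hp).symm (p t) = Submodule.Quotient.mk t := by
      rw [LinearEquiv.symm_apply_eq]; rfl
    simp only [e, LinearEquiv.trans_apply, h]
    rfl
  have hinner : ∀ x y, Y.inner (e x) (e y) = X.inner x y := by
    intro x y
    obtain ⟨s, rfl⟩ := hp x
    obtain ⟨t, rfl⟩ := hp y
    rw [he, he, hpq]
  refine ⟨⟨e, fun b x => ?_, fun a x => ?_, hinner⟩⟩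
  · obtain ⟨t, rfl⟩ := hp x
    rw [← hLp, he, he, hLq]
  -- Right linearity is automatic for an isometric bijection: both sides have the same inner product
  -- with every vector.
  · refine inner_right_ext fun z => ?_
    obtain ⟨z, rfl⟩ := e.surjective z
    rw [hinner, X.inner_ract, Y.inner_ract, hinner]

section Tensor

variable (F : InnerProductBimodule D B) (E : InnerProductBimodule B A)

/-- The projection from the algebraic to the internal tensor product. -/
noncomputable def tensorMk : (F ⊗[Cplx R] E) →ₗ[Cplx R] F.tensor E :=
  (degeneracy F E).mkQ

theorem tensorMk_surjective : Function.Surjective (tensorMk F E) :=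
  (degeneracy F E).mkQ_surjective

theorem inner_tensorMk (z w : F ⊗[Cplx R] E) :
    (F.tensor E).inner (tensorMk F E z) (tensorMk F E w) = tensorForm F E z w := rfl

theorem lact_tensorMk (d : D) (z : F ⊗[Cplx R] E) :
    (F.tensor E).lact d (tensorMk F E z) = tensorMk F E (tensorLact F E d z) := rfl

theorem tensorMk_balanced (y : F) (b : B) (x : E) :
    tensorMk F E (F.ract b y ⊗ₜ x) = tensorMk F E (y ⊗ₜ E.lact b x) := by
  rw [← sub_eq_zero, ← map_sub]
  exact (Submodule.Quotient.mk_eq_zero _).2 (balanced_mem_degeneracy F E y b x)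

variable {F E}

/-- To identify an internal tensor product it suffices to give a surjection from the algebraic
tensor product which is isometric and left linear on elementary tensors. -/
theorem nonempty_tensor_iso {G : InnerProductBimodule D A} (q : (F ⊗[Cplx R] E) →ₗ[Cplx R] G)
    (hq : Function.Surjective q)
    (hinner : ∀ y x y' x', G.inner (q (y ⊗ₜ x)) (q (y' ⊗ₜ x')) =
      E.inner x (E.lact (F.inner y y') x'))
    (hlact : ∀ d y x, q (F.lact d y ⊗ₜ x) = G.lact d (q (y ⊗ₜ x))) :
    Nonempty (Iso (F.tensor E) G) := by
  refine nonempty_iso_of_surjective (tensorMk F E) q (tensorMk_surjective F E) hq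
    (fun t s => ?_) (fun d t => tensorLact F E d t) (fun d t => (lact_tensorMk F E d t).symm)
    (fun d t => ?_)
  · rw [inner_tensorMk]
    induction t with
    | zero => simp
    | add t t' h h' => simp only [map_add, LinearMap.add_apply, h, h']
    | tmul y x =>
      induction s with
      | zero => simp
      | add s s' h h' => simp only [map_add, h, h']
      | tmul y' x' => rw [tensorForm_tmul, hinner]
  · induction t with
    | zero => simp
    | add t t' h h' => simp only [map_add, h, h']
    | tmul y x => rw [tensorLact, LinearMap.rTensor_tmul, hlact]

end Tensor

/-- The action map `b ⊗ x ↦ b · x` is isometric, and it is onto because `B · E = E`. -/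
theorem unit_tensor_iso (E : InnerProductBimodule B A) :
    Nonempty (Iso ((unit B).tensor E) E) := by
  refine nonempty_tensor_iso (F := unit B) (TensorProduct.lift E.lact) ?_ ?_ ?_
  · rw [← LinearMap.range_eq_top, eq_top_iff, ← E.span_lact, Submodule.span_le]
    rintro _ ⟨b, x, rfl⟩
    exact ⟨b ⊗ₜ x, TensorProduct.lift.tmul _ _⟩
  · intro b x b' x'
    rw [TensorProduct.lift.tmul, TensorProduct.lift.tmul, E.inner_lact, ← E.lact_mul]
    rfl
  · intro d b x
    rw [TensorProduct.lift.tmul, TensorProduct.lift.tmul, ← E.lact_mul]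
    rfl

/-- Both sides are quotients of `(F ⊗ E) ⊗ G`, and both induce on it the form `⟨g, ⟨x, ⟨y, y'⟩ · x'⟩
· g'⟩`. -/
theorem tensor_assoc_iso (F : InnerProductBimodule K D) (E : InnerProductBimodule D B)
    (G : InnerProductBimodule B A) :
    Nonempty (Iso ((F.tensor E).tensor G) (F.tensor (E.tensor G))) := by
  refine nonempty_iso_of_surjective (T := (F ⊗[Cplx R] E) ⊗[Cplx R] G)
    (tensorMk (F.tensor E) G ∘ₗ (tensorMk F E).rTensor G)
    (tensorMk F (E.tensor G) ∘ₗ (tensorMk E G).lTensor F ∘ₗ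
      (TensorProduct.assoc (Cplx R) F E G).toLinearMap) ?_ ?_ ?_
    (fun k => (tensorLact F E k).rTensor G) ?_ ?_
  · exact (tensorMk_surjective _ _).comp (LinearMap.rTensor_surjective _ (tensorMk_surjective _ _))
  · exact (tensorMk_surjective _ _).comp ((LinearMap.lTensor_surjective _
      (tensorMk_surjective _ _)).comp (TensorProduct.assoc (Cplx R) F E G).surjective)
  · intro t s
    simp only [LinearMap.comp_apply, inner_tensorMk, LinearEquiv.coe_coe]
    induction t with
    | zero => simp
    | add t t' h h' => simp only [map_add, LinearMap.add_apply, h, h']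
    | tmul t g =>
      induction t with
      | zero => simp
      | add t t' h h' => simp only [map_add, TensorProduct.add_tmul, LinearMap.add_apply, h, h']
      | tmul y x =>
        induction s with
        | zero => simp
        | add s s' h h' => simp only [map_add, h, h']
        | tmul s g' =>
          induction s with
          | zero => simp
          | add s s' h h' => simp only [map_add, TensorProduct.add_tmul, h, h']
          | tmul y' x' =>
            simp only [LinearMap.rTensor_tmul, TensorProduct.assoc_tmul, LinearMap.lTensor_tmul,
              tensorForm_tmul, inner_tensorMk, lact_tensorMk, tensorLact]
  · intro k t
    simp only [LinearMap.comp_apply, lact_tensorMk]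
    congr 1
    induction t with
    | zero => simp
    | add t t' h h' => simp only [map_add, h, h']
    | tmul t g =>
      simp only [LinearMap.rTensor_tmul, tensorLact, lact_tensorMk]
  · intro k t
    simp only [LinearMap.comp_apply, lact_tensorMk, LinearEquiv.coe_coe]
    congr 1
    induction t with
    | zero => simp
    | add t t' h h' => simp only [map_add, h, h']
    | tmul t g =>
      induction t with
      | zero => simp
      | add t t' h h' => simp only [map_add, TensorProduct.add_tmul, h, h']
      | tmul y x => simp [tensorLact]

end InnerProductBimodule

/-! ### Complete positivity of units and internal tensor products -/

section Positivity

variable {R : Type v} [CommRing R] [LinearOrder R]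

theorem Cplx.Nonneg.sum [IsStrictOrderedRing R] {ι : Type*} {s : Finset ι} {f : ι → Cplx R}
    (h : ∀ i ∈ s, Cplx.Nonneg (f i)) : Cplx.Nonneg (∑ i ∈ s, f i) := by
  classical
  induction s using Finset.induction_on with
  | empty => simp [Cplx.Nonneg]
  | insert i s hi ih =>
    rw [Finset.sum_insert hi]
    have h₁ := h i (Finset.mem_insert_self i s)
    have h₂ := ih fun j hj => h j (Finset.mem_insert_of_mem hj)
    exact ⟨by simpa using add_nonneg h₁.1 h₂.1, by simp [h₁.2, h₂.2]⟩

/-- Positive elements are mapped to positive elements by linear maps which send hermitian squares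
to finite sums of positive elements. -/
theorem IsPositiveElement.map {A B : Type u} [NonUnitalRing A] [StarRing A] [Module (Cplx R) A]
    [NonUnitalRing B] [StarRing B] [Module (Cplx R) B] (f : B →ₗ[Cplx R] A)
    (hf : ∀ b, IsPositiveElement R (f (star b * b))) {b : B} (hb : IsPositiveElement R b) :
    IsPositiveElement R (f b) :=
  fun ω hω => hb (ω ∘ₗ f) fun c => hf c ω hω

theorem IsPositiveElement.sum [IsStrictOrderedRing R] {A : Type u} [NonUnitalRing A] [StarRing A] [Module (Cplx R) A]
    {ι : Type*} {s : Finset ι} {f : ι → A} (h : ∀ i ∈ s, IsPositiveElement R (f i)) :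
    IsPositiveElement R (∑ i ∈ s, f i) := by
  intro ω hω
  rw [map_sum]
  exact Cplx.Nonneg.sum fun i hi => h i hi ω hω

end Positivity

/-- Finitely many elements of a tensor product have expansions with the same left factors. -/
theorem TensorProduct.exists_common_expansion {S M N : Type*} [CommRing S] [AddCommGroup M] [AddCommGroup N]
    [Module S M] [Module S N] {n : ℕ} (z : Fin n → M ⊗[S] N) :
    ∃ (N' : ℕ) (y : Fin N' → M) (x : Fin n → Fin N' → N), ∀ i, z i = ∑ p, y p ⊗ₜ x i p := by
  classical
  choose s hs using fun i => TensorProduct.exists_finset (z i)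
  let e := Fintype.equivFin (Σ i, s i)
  -- Concatenate the expansions of all `z i`; in the expansion of `z i` the right factors outside
  -- the `i`-th block are set to zero.
  refine ⟨Fintype.card (Σ i, s i), fun p => ((e.symm p).2 : M × N).1,
    fun i p => if (e.symm p).1 = i then ((e.symm p).2 : M × N).2 else 0, fun i => ?_⟩
  rw [e.symm.sum_comp fun q : (Σ i, s i) => (q.2 : M × N).1 ⊗ₜ[S]
    (if q.1 = i then (q.2 : M × N).2 else 0), Fintype.sum_sigma, Finset.sum_eq_single i]
  · simp only [if_true]
    rw [hs i]
    exact (Finset.sum_coe_sort (s i) fun q => q.1 ⊗ₜ[S] q.2).symm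
  · intro j _ hj
    simp [hj]
  · simp

namespace InnerProductBimodule

variable {R : Type v} [CommRing R] [LinearOrder R]
  {A B D : NIStarAlg.{u, v} R}

/-- The matrix `(x i* x j)` is `M* M`, where `M` has first row `x` and zeros elsewhere; the size `0`
is separate, as there is no first row. -/
theorem isPreHilbert_unit (A : NIStarAlg.{u, v} R) : (unit A).IsPreHilbert := by
  intro n x ω hω
  cases n with
  | zero =>
    have := hω 0
    rwa [Subsingleton.elim (star 0 * 0) (Matrix.of fun i j => (unit A).inner (x i) (x j))] at this
  | succ n =>
    have := hω (Matrix.of fun i j => if i = 0 then x j else 0)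
    convert this
    ext i j
    simp [Matrix.mul_apply, Matrix.star_eq_conjTranspose]

/-- The linear map `(b p q) ↦ (∑ p q, ⟨x i p, b p q · x j q⟩)` between matrix algebras. -/
def compressMatrix (E : InnerProductBimodule B A) {n m : ℕ} (x : Fin n → Fin m → E) :
    Matrix (Fin m) (Fin m) B →ₗ[Cplx R] Matrix (Fin n) (Fin n) A where
  toFun b := Matrix.of fun i j => ∑ p, ∑ q, E.inner (x i p) (E.lact (b p q) (x j q))
  map_add' b b' := by
    ext i j
    simp [Finset.sum_add_distrib]
  map_smul' c b := by
    ext i j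
    simp [Finset.smul_sum]

/-- The image of `c* c` is the sum over the rows `r` of `c` of the Gram matrices of the vectors `∑
p, c r p · x i p`, each positive by hypothesis. -/
theorem IsPreHilbert.compressMatrix_star_mul_self [IsStrictOrderedRing R]
    {E : InnerProductBimodule B A}
    (hE : E.IsPreHilbert) {n m : ℕ} (x : Fin n → Fin m → E) (c : Matrix (Fin m) (Fin m) B) :
    IsPositiveElement R (E.compressMatrix x (star c * c)) := by
  have h : E.compressMatrix x (star c * c) = ∑ r, Matrix.of fun i j =>
      E.inner (∑ p, E.lact (c r p) (x i p)) (∑ q, E.lact (c r q) (x j q)) := by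
    ext i j
    rw [Matrix.sum_apply]
    simp only [compressMatrix, LinearMap.coe_mk, AddHom.coe_mk, Matrix.of_apply, Matrix.mul_apply,
      Matrix.star_apply, map_sum, LinearMap.sum_apply, E.lact_mul, E.inner_lact]
    refine (Finset.sum_congr rfl fun p _ => Finset.sum_comm).trans (Finset.sum_comm.trans ?_)
    exact Finset.sum_congr rfl fun r _ => Finset.sum_comm
  rw [h]
  exact IsPositiveElement.sum fun r _ => hE n _

/-- Writing `z i = ∑ p, y p ⊗ x i p` with the same `y` for all `i`, the Gram matrix of `z` is the
compression along `x` of the Gram matrix of `y`. The latter is positive, and compression preserves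
positivity. -/
theorem IsPreHilbert.tensor [IsStrictOrderedRing R]
    {F : InnerProductBimodule D B} {E : InnerProductBimodule B A}
    (hF : F.IsPreHilbert) (hE : E.IsPreHilbert) : (F.tensor E).IsPreHilbert := by
  intro n z
  choose w hw using fun i => Submodule.Quotient.mk_surjective (degeneracy F E) (z i)
  obtain ⟨m, y, x, hx⟩ := TensorProduct.exists_common_expansion w
  have h := IsPositiveElement.map (E.compressMatrix x) (hE.compressMatrix_star_mul_self x) (hF m y)
  convert h
  ext i j
  change quotientInner F E (z i) (z j) = _
  rw [← hw, ← hw, quotientInner_mk, hx, hx]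
  simp only [compressMatrix, LinearMap.coe_mk, AddHom.coe_mk, Matrix.of_apply, map_sum,
      LinearMap.sum_apply, tensorForm_tmul]
  exact Finset.sum_comm

end InnerProductBimodule

/-! ### From an inverse bimodule to a second inner product -/

namespace InnerProductBimodule

variable {R : Type v} [CommRing R] {A B D K : NIStarAlg.{u, v} R}

/-- A pairing of a `(B, A)`- with an `(A, B)`-bimodule which exhibits `B` as their internal tensor
product. -/
structure Pairing (E : InnerProductBimodule B A) (E' : InnerProductBimodule A B) where
  form : E →ₗ[Cplx R] E' →ₗ[Cplx R] B
  form_lact : ∀ b x v, form (E.lact b x) v = b * form x v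
  form_ract : ∀ b x v, form x (E'.ract b v) = form x v * b
  form_balanced : ∀ a x v, form (E.ract a x) v = form x (E'.lact a v)
  star_form_mul : ∀ x v y w,
    star (form x v) * form y w = E'.inner v (E'.lact (E.inner x y) w)
  span_form : Submodule.span (Cplx R) {b : B | ∃ x v, b = form x v} = ⊤

namespace Pairing

variable {E : InnerProductBimodule B A} {E' : InnerProductBimodule A B}

theorem nonempty_of_iso (e : Iso (E.tensor E') (unit B)) : Nonempty (Pairing E E') := by
  refine ⟨⟨(TensorProduct.mk (Cplx R) E E').compr₂
    (e.toEquiv.toLinearMap ∘ₗ tensorMk E E'), ?_, ?_, ?_, ?_, ?_⟩⟩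
  · intro b x v
    exact e.map_lact b (tensorMk E E' (x ⊗ₜ v))
  · intro b x v
    exact e.map_ract b (tensorMk E E' (x ⊗ₜ v))
  · intro a x v
    exact congrArg e.toEquiv (tensorMk_balanced E E' x a v)
  · intro x v y w
    refine (e.map_inner (tensorMk E E' (x ⊗ₜ v)) (tensorMk E E' (y ⊗ₜ w))).trans ?_
    rw [inner_tensorMk, tensorForm_tmul]
  · rw [eq_top_iff]
    intro b _
    obtain ⟨z, rfl⟩ := e.toEquiv.surjective b
    obtain ⟨t, rfl⟩ := tensorMk_surjective E E' z
    induction t with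
    | zero => rw [map_zero, map_zero]; exact zero_mem _
    | add t t' h h' => rw [map_add, map_add]; exact add_mem (h trivial) (h' trivial)
    | tmul x v => exact Submodule.subset_span ⟨x, v, rfl⟩

/-- If `b` kills `E`, then `b * form x v = form (b · x) v = 0`; these values span `B`, which is
non-degenerate. -/
theorem lact_faithful (P : Pairing E E') (b : B) (h : ∀ x, E.lact b x = 0) : b = 0 := by
  refine B.nondeg_right b fun c => ?_
  have hc : c ∈ Submodule.span (Cplx R) {b : B | ∃ x v, b = P.form x v} := by
    rw [P.span_form]; trivial
  induction hc using Submodule.span_induction with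
  | mem c hc =>
    obtain ⟨x, v, rfl⟩ := hc
    rw [← P.form_lact, h, map_zero, LinearMap.zero_apply]
  | zero => rw [mul_zero]
  | add c c' _ _ hc hc' => rw [mul_add, hc, hc', add_zero]
  | smul r c _ hc => rw [mul_smul_comm, hc, smul_zero]

/-- `B` is spanned by products, hence by the products `star (form x v) * form y w`, and each of
these is an inner product of vectors of `E'`. -/
theorem span_inner (P : Pairing E E') :
    Submodule.span (Cplx R) {b : B | ∃ v w : E', b = E'.inner v w} = ⊤ := by
  rw [eq_top_iff, ← B.idempotent, Submodule.span_le]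
  rintro _ ⟨b, c, rfl⟩
  obtain ⟨b, rfl⟩ := star_involutive.surjective b
  have hb : b ∈ Submodule.span (Cplx R) {b : B | ∃ x v, b = P.form x v} := by
    rw [P.span_form]; trivial
  have hc : c ∈ Submodule.span (Cplx R) {b : B | ∃ x v, b = P.form x v} := by
    rw [P.span_form]; trivial
  rw [SetLike.mem_coe]
  induction hb using Submodule.span_induction with
  | mem b hb =>
    obtain ⟨x, v, rfl⟩ := hb
    induction hc using Submodule.span_induction with
    | mem c hc =>
      obtain ⟨y, w, rfl⟩ := hc
      exact Submodule.subset_span ⟨v, _, P.star_form_mul x v y w⟩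
    | zero => rw [mul_zero]; exact zero_mem _
    | add c c' _ _ hc hc' => rw [mul_add]; exact add_mem hc hc'
    | smul r c _ hc => rw [mul_smul_comm]; exact Submodule.smul_mem _ _ hc
  | zero => rw [star_zero, zero_mul]; exact zero_mem _
  | add b b' _ _ hb hb' => rw [star_add, add_mul]; exact add_mem hb hb'
  | smul r b _ hb => rw [star_smul, smul_mul_assoc]; exact Submodule.smul_mem _ _ hb

/-- The functionals `v ↦ form x v` are represented by elements of `E'`. -/
theorem exists_dual (P : Pairing E E') (x : E) :
    ∃ w : E', ∀ v, E'.inner w v = P.form x v := by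
  have hx : x ∈ Submodule.span (Cplx R) {z : E | ∃ (b : B) (x : E), z = E.lact b x} := by
    rw [E.span_lact]; trivial
  induction hx using Submodule.span_induction with
  | mem x hx =>
    obtain ⟨b, x, rfl⟩ := hx
    obtain ⟨b, rfl⟩ := star_involutive.surjective b
    have hb : b ∈ Submodule.span (Cplx R) {b : B | ∃ x v, b = P.form x v} := by
      rw [P.span_form]; trivial
    induction hb using Submodule.span_induction with
    | mem b hb =>
      obtain ⟨y, w, rfl⟩ := hb
      -- As `E = B · E` and the elements `star (form y w)` span `B`, it suffices to treat `star
      -- (form y w) · x`. Its functional is `v ↦ star (form y w) * form x v = ⟨w, ⟨y, x⟩ · v⟩`, and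
      -- `⟨y, x⟩` moves to the left slot as `⟨x, y⟩`.
      refine ⟨E'.lact (E.inner x y) w, fun v => ?_⟩
      rw [P.form_lact, P.star_form_mul, E'.inner_lact, E.star_inner]
    | zero => exact ⟨0, fun v => by simp⟩
    | add b b' _ _ hb hb' =>
      obtain ⟨w, hw⟩ := hb
      obtain ⟨w', hw'⟩ := hb'
      exact ⟨w + w', fun v => by simp [hw, hw']⟩
    | smul r b _ hb =>
      obtain ⟨w, hw⟩ := hb
      exact ⟨r • w, fun v => by simp [hw, starRingEnd_apply]⟩
  | zero => exact ⟨0, fun v => by simp⟩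
  | add x x' _ _ hx hx' =>
    obtain ⟨w, hw⟩ := hx
    obtain ⟨w', hw'⟩ := hx'
    exact ⟨w + w', fun v => by simp [hw, hw']⟩
  | smul r x _ hx =>
    obtain ⟨w, hw⟩ := hx
    exact ⟨star r • w, fun v => by simp [hw, starRingEnd_apply]⟩

/-- The antilinear map `E → E'` determined by `⟨dual x, v⟩ = form x v`. -/
noncomputable def dual (P : Pairing E E') : E →ₗ⋆[Cplx R] E' where
  toFun x := (P.exists_dual x).choose
  map_add' x y := inner_left_ext fun v => by
    rw [(P.exists_dual (x + y)).choose_spec, map_add, map_add, LinearMap.add_apply,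
      LinearMap.add_apply, (P.exists_dual x).choose_spec, (P.exists_dual y).choose_spec]
  map_smul' c x := inner_left_ext fun v => by
    rw [(P.exists_dual (c • x)).choose_spec, map_smul, map_smulₛₗ, LinearMap.smul_apply,
      LinearMap.smul_apply, (P.exists_dual x).choose_spec, starRingEnd_self_apply]

theorem inner_dual (P : Pairing E E') (x : E) (v : E') :
    E'.inner (P.dual x) v = P.form x v :=
  (P.exists_dual x).choose_spec v

theorem inner_dual_right (P : Pairing E E') (x : E) (v : E') :
    E'.inner v (P.dual x) = star (P.form x v) := by
  rw [← E'.star_inner, inner_dual]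

theorem dual_ract (P : Pairing E E') (a : A) (x : E) :
    P.dual (E.ract a x) = E'.lact (star a) (P.dual x) :=
  inner_left_ext fun v => by
    rw [inner_dual, P.form_balanced, E'.inner_lact, inner_dual, star_star]

/-- The compatibility of the two inner products as seen on `E'`; `ract_inner` transports it back to
`E`. -/
theorem ract_dual_form (P : Pairing E E') (y z : E) (w : E') :
    E'.ract (P.form z w) (P.dual y) = E'.lact (E.inner y z) w :=
  inner_right_ext fun v => by
    rw [E'.inner_ract, inner_dual_right, P.star_form_mul]

/-- Exhibits every `⟨x, y⟩ · w` as a value of `dual`, which is what surjectivity needs. -/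
theorem dual_lact_star_form (P : Pairing E E') (x y : E) (w : E') :
    P.dual (E.lact (star (P.form y w)) x) = E'.lact (E.inner x y) w :=
  inner_left_ext fun v => by
    rw [inner_dual, P.form_lact, P.star_form_mul, E'.inner_lact, E.star_inner]

/-- If `form x = 0`, then `⟨w, ⟨y, x⟩ · v⟩ = star (form y w) * form x v = 0`, so every `⟨y, x⟩` acts
as zero on `E'`. By `Q` the action of `A` on `E'` is faithful, hence `⟨y, x⟩ = 0`. -/
theorem eq_zero_of_form (P : Pairing E E') (Q : Pairing E' E) {x : E}
    (h : ∀ v, P.form x v = 0) : x = 0 := by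
  refine inner_right_ext (fun y => ?_)
  rw [map_zero]
  refine Q.lact_faithful _ fun v => inner_right_ext fun w => ?_
  rw [← P.star_form_mul, h, mul_zero, map_zero]

/-- `E' = A · E'`, and by `Q` the algebra `A` is spanned by the values `⟨x, y⟩`, for which `⟨x, y⟩ ·
w` lies in the range. -/
theorem dual_surjective (P : Pairing E E') (Q : Pairing E' E) :
    Function.Surjective P.dual := by
  have key : ∀ (a : A) (w : E'), E'.lact a w ∈ LinearMap.range P.dual := by
    intro a w
    have ha : a ∈ Submodule.span (Cplx R) {a : A | ∃ x y : E, a = E.inner x y} := by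
      rw [Q.span_inner]; trivial
    induction ha using Submodule.span_induction with
    | mem a ha =>
      obtain ⟨x, y, rfl⟩ := ha
      exact ⟨_, P.dual_lact_star_form x y w⟩
    | zero => rw [map_zero]; exact zero_mem _
    | add a a' _ _ ha ha' => rw [map_add]; exact add_mem ha ha'
    | smul r a _ ha => rw [map_smul]; exact Submodule.smul_mem _ _ ha
  rw [← LinearMap.range_eq_top, eq_top_iff, ← E'.span_lact, Submodule.span_le]
  rintro _ ⟨a, w, rfl⟩
  exact key a w

/-- The `B`-valued inner product `⟨x, y⟩ = form x (dual y)` on `E`. -/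
noncomputable def leftInner (P : Pairing E E') : E →ₗ[Cplx R] E →ₗ⋆[Cplx R] B :=
  LinearMap.mk₂'ₛₗ (RingHom.id (Cplx R)) (starRingEnd (Cplx R))
    (fun x y => P.form x (P.dual y)) (by simp) (by simp) (by simp) (by simp)

theorem leftInner_apply (P : Pairing E E') (x y : E) :
    P.leftInner x y = P.form x (P.dual y) := rfl

/-- This form makes hermitian symmetry evident and carries complete positivity over from `E'`. -/
theorem leftInner_eq_inner_dual (P : Pairing E E') (x y : E) :
    P.leftInner x y = E'.inner (P.dual x) (P.dual y) := by
  rw [leftInner_apply, inner_dual]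

/-- Both sides pair equally with every `w`: one gives `form x (⟨y, z⟩ · w)`, the other `form x (dual
y) * form z w = form x (dual y · form z w)`. -/
theorem ract_inner (P : Pairing E E') (Q : Pairing E' E) (x y z : E) :
    E.ract (E.inner y z) x = E.lact (P.leftInner x y) z := by
  rw [← sub_eq_zero]
  refine P.eq_zero_of_form Q fun w => ?_
  rw [map_sub, LinearMap.sub_apply, sub_eq_zero, P.form_balanced, P.form_lact, leftInner_apply,
    ← P.form_ract, ract_dual_form]

theorem isStarEquivalence (P : Pairing E E') (Q : Pairing E' E) :
    IsStarEquivalence E P.leftInner := by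
  have hfull : Submodule.span (Cplx R) {b : B | ∃ x y : E, b = P.leftInner x y} = ⊤ := by
    rw [eq_top_iff, ← P.span_form, Submodule.span_le]
    rintro _ ⟨x, v, rfl⟩
    obtain ⟨y, rfl⟩ := P.dual_surjective Q v
    exact Submodule.subset_span ⟨x, y, rfl⟩
  refine ⟨fun x y => ?_, fun b x y => P.form_lact b x _, fun x hx => P.eq_zero_of_form Q fun v => ?_,
    hfull, fun a x y => ?_, Q.span_inner, P.ract_inner Q, ?_⟩
  · rw [leftInner_eq_inner_dual, leftInner_eq_inner_dual, E'.star_inner]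
  · obtain ⟨y, rfl⟩ := P.dual_surjective Q v
    exact hx y
  · rw [leftInner_apply, leftInner_apply, dual_ract, P.form_balanced, star_star]
  -- `E · A = E` follows from `B · E = E`: by fullness `b` may be taken to be `_B⟨x, y⟩`, and then
  -- `b · z = x · ⟨y, z⟩_A`.
  · rw [eq_top_iff, ← E.span_lact, Submodule.span_le]
    rintro _ ⟨b, z, rfl⟩
    have hb : b ∈ Submodule.span (Cplx R) {b : B | ∃ x y : E, b = P.leftInner x y} := by
      rw [hfull]; trivial
    rw [SetLike.mem_coe]
    induction hb using Submodule.span_induction with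
    | mem b hb =>
      obtain ⟨x, y, rfl⟩ := hb
      exact Submodule.subset_span ⟨_, x, (P.ract_inner Q x y z).symm⟩
    | zero => rw [map_zero, LinearMap.zero_apply]; exact zero_mem _
    | add b b' _ _ hb hb' => rw [map_add, LinearMap.add_apply]; exact add_mem hb hb'
    | smul r b _ hb => rw [map_smul, LinearMap.smul_apply]; exact Submodule.smul_mem _ _ hb

end Pairing

end InnerProductBimodule

/-! ### The conjugate bimodule as an inverse -/

namespace InnerProductBimodule

variable {R : Type v} [CommRing R] {A B D K : NIStarAlg.{u, v} R}

/-- The underlying group of a bimodule, to be equipped with the conjugate module structure. -/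
def ConjCarrier (E : InnerProductBimodule B A) : Type u := E.carrier

instance (E : InnerProductBimodule B A) : AddCommGroup (ConjCarrier E) := E.addCommGroup

instance (E : InnerProductBimodule B A) : Module (Cplx R) (ConjCarrier E) :=
  Module.compHom E.carrier (starRingEnd (Cplx R))

/-- The identity as an antilinear equivalence to the conjugate module. -/
def toConj (E : InnerProductBimodule B A) : E ≃ₗ⋆[Cplx R] ConjCarrier E where
  toFun x := x
  invFun x := x
  left_inv _ := rfl
  right_inv _ := rfl
  map_add' _ _ := rfl
  map_smul' c x := by
    change c • x = starRingEnd (Cplx R) (starRingEnd (Cplx R) c) • x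
    rw [starRingEnd_self_apply]

@[simp]
theorem toConj_smul (E : InnerProductBimodule B A) (c : Cplx R) (x : E) :
    E.toConj (c • x) = star c • E.toConj x :=
  E.toConj.map_smulₛₗ c x

@[simp]
theorem toConj_symm_add (E : InnerProductBimodule B A) (x y : ConjCarrier E) :
    E.toConj.symm (x + y) = E.toConj.symm x + E.toConj.symm y := rfl

@[simp]
theorem toConj_symm_smul (E : InnerProductBimodule B A) (c : Cplx R) (x : ConjCarrier E) :
    E.toConj.symm (c • x) = star c • E.toConj.symm x := rfl

end InnerProductBimodule

namespace IsStarEquivalence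

open InnerProductBimodule

variable {R : Type v} [CommRing R] {A B D K : NIStarAlg.{u, v} R}
variable {E : InnerProductBimodule B A} {ip : E →ₗ[Cplx R] E →ₗ⋆[Cplx R] B}

theorem ip_lact_right (h : IsStarEquivalence E ip) (b : B) (x y : E) :
    ip x (E.lact b y) = ip x y * star b := by
  rw [← h.star_ip, h.ip_lact, star_mul, h.star_ip]

/-- The conjugate bimodule of a star equivalence bimodule. -/
noncomputable def conj (h : IsStarEquivalence E ip) : InnerProductBimodule A B where
  carrier := ConjCarrier E
  lact := LinearMap.mk₂ (Cplx R)
    (fun a x => E.toConj (E.ract (star a) (E.toConj.symm x)))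
    (by simp) (by simp) (by simp) (by simp)
  ract := LinearMap.mk₂ (Cplx R)
    (fun b x => E.toConj (E.lact (star b) (E.toConj.symm x)))
    (by simp) (by simp) (by simp) (by simp)
  lact_mul a a' x := by simp [E.ract_mul]
  ract_mul b b' x := by simp [E.lact_mul]
  lact_ract a b x := by simp [E.lact_ract]
  inner := LinearMap.mk₂'ₛₗ (starRingEnd (Cplx R)) (RingHom.id (Cplx R))
    (fun x y => ip (E.toConj.symm x) (E.toConj.symm y))
    (by simp) (by simp [starRingEnd_apply]) (by simp) (by simp [starRingEnd_apply])
  star_inner x y := h.star_ip _ _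
  inner_ract x y b := by simp [h.ip_lact_right]
  inner_nondeg x hx := h.ip_nondeg x hx
  inner_lact a x y := by simp [h.ip_ract]
  span_lact := by
    have key : ∀ x : E, E.toConj x ∈ Submodule.span (Cplx R)
        {z | ∃ (a : A) (x : ConjCarrier E), z = E.toConj (E.ract (star a) (E.toConj.symm x))} := by
      intro x
      have hx : x ∈ Submodule.span (Cplx R) {z : E | ∃ (a : A) (x : E), z = E.ract a x} := by
        rw [h.span_ract]; trivial
      induction hx using Submodule.span_induction with
      | mem x hx =>
        obtain ⟨a, x, rfl⟩ := hx
        exact Submodule.subset_span ⟨star a, E.toConj x, by simp⟩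
      | zero => rw [map_zero]; exact zero_mem _
      | add x y _ _ hx hy => rw [map_add]; exact add_mem hx hy
      | smul c x _ hx => rw [map_smulₛₗ]; exact Submodule.smul_mem _ _ hx
    exact eq_top_iff.2 fun x _ => key x

theorem conj_tensor_iso (h : IsStarEquivalence E ip) :
    Nonempty (Iso (h.conj.tensor E) (unit A)) := by
  let f : h.conj →ₗ[Cplx R] E →ₗ[Cplx R] A :=
    E.inner.comp (E.toConj.symm : ConjCarrier E →ₗ⋆[Cplx R] E)
  refine nonempty_tensor_iso (TensorProduct.lift f) ?_ ?_ ?_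
  · rw [← LinearMap.range_eq_top, eq_top_iff, ← h.inner_full, Submodule.span_le]
    rintro _ ⟨x, y, rfl⟩
    exact ⟨E.toConj x ⊗ₜ y, TensorProduct.lift.tmul _ _⟩
  · intro y x y' x'
    -- Isometry is the compatibility relation: `⟨x, y⟩_A ⟨y', x'⟩_A = ⟨x, y · ⟨y', x'⟩_A⟩_A = ⟨x,
    -- _B⟨y, y'⟩ · x'⟩_A`.
    change star (E.inner (E.toConj.symm y) x) * E.inner (E.toConj.symm y') x' =
      E.inner x (E.lact (ip (E.toConj.symm y) (E.toConj.symm y')) x')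
    rw [E.star_inner, ← h.ract_inner, E.inner_ract]
  · intro a y x
    change E.inner (E.ract (star a) (E.toConj.symm y)) x = a * E.inner (E.toConj.symm y) x
    rw [E.inner_ract_left, star_star]

theorem tensor_conj_iso (h : IsStarEquivalence E ip) :
    Nonempty (Iso (E.tensor h.conj) (unit B)) := by
  let f : E →ₗ[Cplx R] ConjCarrier E →ₗ[Cplx R] B := LinearMap.mk₂ (Cplx R)
    (fun x y => ip x (E.toConj.symm y)) (by simp) (by simp) (by simp) (by simp [starRingEnd_apply])
  refine nonempty_tensor_iso (E := h.conj) (TensorProduct.lift f) ?_ ?_ ?_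
  · rw [← LinearMap.range_eq_top, eq_top_iff, ← h.ip_full, Submodule.span_le]
    rintro _ ⟨x, y, rfl⟩
    exact ⟨x ⊗ₜ E.toConj y, TensorProduct.lift.tmul _ _⟩
  · intro x y x' y'
    -- Here `y' · ⟨x', x⟩_A = _B⟨y', x'⟩ · x`, and the coefficient leaves the second slot of `ip` as
    -- its adjoint `_B⟨x', y'⟩` on the right.
    change star (ip x (E.toConj.symm y)) * ip x' (E.toConj.symm y') =
      ip (E.toConj.symm y) (E.ract (star (E.inner x x')) (E.toConj.symm y'))
    rw [E.star_inner, h.ract_inner, h.ip_lact_right, h.star_ip, h.star_ip]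
  · intro b x y
    exact h.ip_lact b x _

end IsStarEquivalence

/-! ### The groupoids and the characterization of invertible classes -/

namespace BimMor

open InnerProductBimodule

variable {R : Type v} [CommRing R] {A B D K : NIStarAlg.{u, v} R}

theorem mk_eq_mk {E F : InnerProductBimodule B A} : mk E = mk F ↔ Nonempty (Iso E F) :=
  Quotient.eq

theorem mk_surjective (f : BimMor B A) : ∃ E, mk E = f :=
  Quotient.exists_rep f

theorem comp_assoc (f : BimMor K D) (g : BimMor D B) (h : BimMor B A) :
    comp (comp f g) h = comp f (comp g h) := by
  obtain ⟨F, rfl⟩ := mk_surjective f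
  obtain ⟨G, rfl⟩ := mk_surjective g
  obtain ⟨H, rfl⟩ := mk_surjective h
  exact mk_eq_mk.2 (tensor_assoc_iso F G H)

theorem id_comp (f : BimMor B A) : comp (id B) f = f := by
  obtain ⟨F, rfl⟩ := mk_surjective f
  exact mk_eq_mk.2 (unit_tensor_iso F)

theorem isInvertible_id (A : NIStarAlg.{u, v} R) : (id A).IsInvertible :=
  ⟨id A, id_comp _, id_comp _⟩

/-- With an inverse `g`, the right unit law reduces to the left one: `f ∘ (g ∘ f) = (f ∘ g) ∘ f = id
∘ f`. -/
theorem IsInvertible.comp_id {f : BimMor B A} (hf : f.IsInvertible) : comp f (id A) = f := by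
  obtain ⟨g, hgf, hfg⟩ := hf
  rw [← hgf, ← comp_assoc, hfg, id_comp]

theorem comp_comp_eq_id {f : BimMor D B} {g : BimMor B A} {f' : BimMor B D} {g' : BimMor A B}
    (hf : comp f' f = id B) (hg : comp g' g = id A) :
    comp (comp g' f') (comp f g) = id A := by
  rw [comp_assoc, ← comp_assoc f', hf, id_comp, hg]

theorem IsInvertible.comp {f : BimMor D B} {g : BimMor B A} (hf : f.IsInvertible)
    (hg : g.IsInvertible) : (comp f g).IsInvertible := by
  obtain ⟨f', hf, hf'⟩ := hf
  obtain ⟨g', hg, hg'⟩ := hg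
  exact ⟨BimMor.comp g' f', comp_comp_eq_id hf hg, comp_comp_eq_id hg' hf'⟩

theorem formGroupoid_isInvertible :
    FormGroupoid.{u, v} (R := R) (fun f => f.IsInvertible) where
  id_mem := isInvertible_id
  comp_mem _ _ hf hg := hf.comp hg
  assoc f g h _ _ _ := comp_assoc f g h
  id_comp f _ := id_comp f
  comp_id _ hf := hf.comp_id
  inv_mem _ := fun ⟨g, hgf, hfg⟩ => ⟨g, ⟨_, hfg, hgf⟩, hgf, hfg⟩

theorem isInvertible_mk_iff (E : InnerProductBimodule B A) :
    (mk E).IsInvertible ↔ ∃ ip : E →ₗ[Cplx R] E →ₗ⋆[Cplx R] B, IsStarEquivalence E ip := by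
  constructor
  · rintro ⟨g, hgf, hfg⟩
    obtain ⟨E', rfl⟩ := mk_surjective g
    obtain ⟨P⟩ := (mk_eq_mk.1 hfg).elim Pairing.nonempty_of_iso
    obtain ⟨Q⟩ := (mk_eq_mk.1 hgf).elim Pairing.nonempty_of_iso
    exact ⟨P.leftInner, P.isStarEquivalence Q⟩
  · rintro ⟨ip, h⟩
    exact ⟨mk h.conj, mk_eq_mk.2 h.conj_tensor_iso, mk_eq_mk.2 h.tensor_conj_iso⟩

section Ordered

variable [LinearOrder R]

theorem isPreHilbert_mk_iff {E : InnerProductBimodule B A} :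
    (mk E).IsPreHilbert ↔ E.IsPreHilbert :=
  ⟨fun ⟨_, hF, h⟩ => (mk_eq_mk.1 h).elim fun e => e.isPreHilbert hF, fun h => ⟨E, h, rfl⟩⟩

theorem isPreHilbert_id (A : NIStarAlg.{u, v} R) : (id A).IsPreHilbert :=
  isPreHilbert_mk_iff.2 (isPreHilbert_unit A)

theorem IsPreHilbert.comp [IsStrictOrderedRing R] {f : BimMor D B} {g : BimMor B A}
    (hf : f.IsPreHilbert) (hg : g.IsPreHilbert) : (comp f g).IsPreHilbert := by
  obtain ⟨F, hF, rfl⟩ := hf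
  obtain ⟨G, hG, rfl⟩ := hg
  exact isPreHilbert_mk_iff.2 (hF.tensor hG)

theorem IsStronglyInvertible.isInvertible {f : BimMor B A} (hf : f.IsStronglyInvertible) :
    f.IsInvertible := by
  obtain ⟨-, g, -, h⟩ := hf
  exact ⟨g, h⟩

theorem formGroupoid_isStronglyInvertible [IsStrictOrderedRing R] :
    FormGroupoid.{u, v} (R := R) (fun f => f.IsStronglyInvertible) where
  id_mem A := ⟨isPreHilbert_id A, id A, isPreHilbert_id A, id_comp _, id_comp _⟩
  comp_mem _ _ := fun ⟨hf, f', hf', h₁, h₂⟩ ⟨hg, g', hg', h₃, h₄⟩ =>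
    ⟨hf.comp hg, comp g' f', hg'.comp hf', comp_comp_eq_id h₁ h₃, comp_comp_eq_id h₄ h₂⟩
  assoc f g h _ _ _ := comp_assoc f g h
  id_comp f _ := id_comp f
  comp_id _ hf := hf.isInvertible.comp_id
  inv_mem _ := fun ⟨hf, g, hg, hgf, hfg⟩ => ⟨g, ⟨hg, _, hf, hfg, hgf⟩, hgf, hfg⟩

theorem isStronglyInvertible_mk_iff {E : InnerProductBimodule B A} (hE : E.IsPreHilbert) :
    (mk E).IsStronglyInvertible ↔
      ∃ ip : E →ₗ[Cplx R] E →ₗ⋆[Cplx R] B, IsStrongEquivalence E ip := by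
  constructor
  · rintro ⟨-, _, ⟨E', hE', rfl⟩, hgf, hfg⟩
    obtain ⟨P⟩ := (mk_eq_mk.1 hfg).elim Pairing.nonempty_of_iso
    obtain ⟨Q⟩ := (mk_eq_mk.1 hgf).elim Pairing.nonempty_of_iso
    refine ⟨P.leftInner, P.isStarEquivalence Q, hE, fun n x => ?_⟩
    simpa only [P.leftInner_eq_inner_dual] using hE' n fun i => P.dual (x i)
  · rintro ⟨ip, h, -, hip⟩
    -- The inner product of the conjugate bimodule is `ip` itself on the same underlying set.
    have hconj : h.conj.IsPreHilbert := fun n x => hip n x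
    exact ⟨⟨E, hE, rfl⟩, mk h.conj, ⟨_, hconj, rfl⟩, mk_eq_mk.2 h.conj_tensor_iso,
      mk_eq_mk.2 h.tensor_conj_iso⟩

end Ordered

end BimMor

theorem theorem6p1 {R : Type v} [CommRing R] [LinearOrder R] [IsStrictOrderedRing R] :
    (∀ (A B : NIStarAlg.{u, v} R) (E : InnerProductBimodule B A),
      (BimMor.mk E).IsInvertible ↔
        ∃ ip : E →ₗ[Cplx R] E →ₗ⋆[Cplx R] B, IsStarEquivalence E ip) ∧
    (∀ (A B : NIStarAlg.{u, v} R) (E : InnerProductBimodule B A), E.IsPreHilbert →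
      ((BimMor.mk E).IsStronglyInvertible ↔
        ∃ ip : E →ₗ[Cplx R] E →ₗ⋆[Cplx R] B, IsStrongEquivalence E ip)) ∧
    (∀ A B : NIStarAlg.{u, v} R,
      StarMoritaEquivalent A B ↔ ∃ f : BimMor B A, f.IsInvertible) ∧
    (∀ A B : NIStarAlg.{u, v} R,
      StronglyMoritaEquivalent A B ↔ ∃ f : BimMor B A, f.IsStronglyInvertible) ∧
    BimMor.FormGroupoid.{u, v} (R := R) (fun f => f.IsInvertible) ∧
    BimMor.FormGroupoid.{u, v} (R := R) (fun f => f.IsStronglyInvertible) := by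
  refine ⟨fun A B E => BimMor.isInvertible_mk_iff E,
    fun A B E hE => BimMor.isStronglyInvertible_mk_iff hE, fun A B => ⟨?_, ?_⟩,
    fun A B => ⟨?_, ?_⟩, BimMor.formGroupoid_isInvertible,
    BimMor.formGroupoid_isStronglyInvertible⟩
  · rintro ⟨E, h⟩
    exact ⟨_, (BimMor.isInvertible_mk_iff E).2 h⟩
  · rintro ⟨f, hf⟩
    obtain ⟨E, rfl⟩ := BimMor.mk_surjective f
    exact ⟨E, (BimMor.isInvertible_mk_iff E).1 hf⟩
  · rintro ⟨E, ip, h⟩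
    exact ⟨_, (BimMor.isStronglyInvertible_mk_iff h.2.1).2 ⟨ip, h⟩⟩
  · rintro ⟨f, hf⟩
    obtain ⟨E, hE, rfl⟩ := hf.1
    exact ⟨E, (BimMor.isStronglyInvertible_mk_iff hE).1 hf⟩
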